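/- Let $\mathbb F$ be a field. All simplicial complexes are finite and abstract, and the empty set is a face of each of them; a face $\sigma$ has dimension $\#\sigma-1$, a facet is a maximal face, and $\mathrm{lk}_X(\sigma)=\{\tau : \tau\cap\sigma=\emptyset,\ \tau\cup\sigma\in X\}$. Homology is reduced simplicial homology with coefficients in $\mathbb F$. An $\mathbb F$-homology sphere of dimension $d\ge -1$ is a complex $S$ such that for every face $\sigma$ of $S$ (including $\emptyset$) one has $\widetilde H_{i}(\mathrm{lk}_S(\sigma))\cong\mathbb F$ for $i=d-\#\sigma$ and $\widetilde H_{i}(\mathrm{lk}_S(\sigma))=0$ for $i\neq d-\#\sigma$. For a complex $X$ of dimension $d \geq 0$, the boundary $\partial X$ is the subcomplex consisting of $\emptyset$ and all subsets of those $(d-1)$-dimensional faces of $X$ that are contained in a unique facet of $X$. An $\mathbb F$-homology ball of dimension $d\ge 0$ is a complex $B$ such that $\partial B$ is an $\mathbb F$-homology sphere of dimension $d-1$ and, for every face $\sigma$ of $B$: if $\sigma\in\partial B$, then $\widetilde H_i(\mathrm{lk}_B(\sigma))=0$ for all $i$ (for $\sigma=\emptyset$: $B$ is acyclic); if $\sigma\notin\partial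 B$, then $\widetilde H_i(\mathrm{lk}_B(\sigma))$ is $\mathbb F$ for $i=d-\#\sigma$ and $0$ for $i\ne d-\#\sigma$. For an integer $k\ge 0$, a $d$-dimensional $\mathbb F$-homology ball $B$ is $k$-stacked if every face of $B$ of codimension at least $k+1$ (that is, of dimension at most $d-k-1$) lies in $\partial B$. A missing face of $B$ is a set $\alpha$ of vertices of $B$ that is not a face of $B$ although all proper subsets of $\alpha$ are faces of $B$; its dimension is $\#\alpha-1$. Lemma 2. Let $B$ be a $k$-stacked $\mathbb F$-homology ball. Then all the missing faces of $B$ have dimension $\le k$. -/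

import Mathlib

noncomputable section

namespace PreAbstractSimplicialComplex

variable {V : Type*}

/-- The empty set is a face of every simplicial complex, by convention. -/
def IsFace (K : PreAbstractSimplicialComplex V) (σ : Finset V) : Prop :=
  σ = ∅ ∨ σ ∈ K.faces

/-- The dimension `#σ - 1` of a simplex; the empty simplex has dimension `-1`. -/
def simplexDim (σ : Finset V) : ℤ := (σ.card : ℤ) - 1

/-- A facet is a maximal face. -/
def IsFacet (K : PreAbstractSimplicialComplex V) (σ : Finset V) : Prop :=
  K.IsFace σ ∧ ∀ τ, K.IsFace τ → σ ⊆ τ → τ = σ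

/-- The link of `σ`: all `τ` disjoint from `σ` such that `τ ∪ σ` is a face. -/
def link [DecidableEq V] (K : PreAbstractSimplicialComplex V) (σ : Finset V) :
    PreAbstractSimplicialComplex V where
  faces := {τ | τ.Nonempty ∧ Disjoint τ σ ∧ τ ∪ σ ∈ K.faces}
  isRelLowerSet_faces := by
    rintro τ ⟨hne, hdis, hmem⟩
    refine ⟨hne, fun ρ hρ hρne => ⟨hρne, hdis.mono_left hρ, ?_⟩⟩
    exact (K.isRelLowerSet_faces hmem).2 (Finset.union_subset_union_left hρ)
      (hρne.mono Finset.subset_union_left)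

/-- The boundary of a `d`-dimensional complex: the subcomplex generated by the faces of
dimension `d - 1` that are contained in a unique facet. -/
def boundary (K : PreAbstractSimplicialComplex V) (d : ℤ) : PreAbstractSimplicialComplex V where
  faces := {σ | σ.Nonempty ∧ ∃ τ, K.IsFace τ ∧ simplexDim τ = d - 1 ∧
    (∃! ρ, K.IsFacet ρ ∧ τ ⊆ ρ) ∧ σ ⊆ τ}
  isRelLowerSet_faces := by
    rintro σ ⟨hne, τ, h1, h2, h3, h4⟩
    exact ⟨hne, fun ρ hρ hρne => ⟨hρne, τ, h1, h2, h3, hρ.trans h4⟩⟩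

/-! ### Reduced simplicial homology with coefficients in a field

The augmented oriented chain complex, each simplex being oriented by a fixed linear order of the
vertices. All chain groups are realised inside the free module on all finite sets of vertices. -/

section Homology

variable (F : Type*) [Field F]

/-- The quotient `Z / (B ⊓ Z)` of two submodules; it is `Z / B` when `B ≤ Z`. -/
def Subquotient {F M : Type*} [Field F] [AddCommGroup M] [Module F M] (Z B : Submodule F M) :
    Type _ :=
  Z ⧸ B.submoduleOf Z

instance {F M : Type*} [Field F] [AddCommGroup M] [Module F M] (Z B : Submodule F M) :
    AddCommGroup (Subquotient Z B) :=
  inferInstanceAs (AddCommGroup (Z ⧸ B.submoduleOf Z))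

instance {F M : Type*} [Field F] [AddCommGroup M] [Module F M] (Z B : Submodule F M) :
    Module F (Subquotient Z B) :=
  inferInstanceAs (Module F (Z ⧸ B.submoduleOf Z))

/-- The boundary operator: `∂ {v₀ < ⋯ < vᵢ} = ∑ⱼ (-1) ^ j • {v₀, …, vᵢ} \ {vⱼ}`.
On vertices this is the augmentation `∂ {v} = ∅`, and `∂ ∅ = 0`. -/
def chainBoundary [LinearOrder V] : (Finset V →₀ F) →ₗ[F] (Finset V →₀ F) :=
  Finsupp.linearCombination F fun σ : Finset V =>
    ∑ v ∈ σ, Finsupp.single (σ.erase v) ((-1 : F) ^ (σ.filter (· < v)).card)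

/-- The `i`-chains of `K`: linear combinations of the `i`-dimensional faces (`i = -1` gives the
span of the empty face). -/
def chains (K : PreAbstractSimplicialComplex V) (i : ℤ) : Submodule F (Finset V →₀ F) :=
  Finsupp.supported F F {σ | K.IsFace σ ∧ simplexDim σ = i}

/-- The `i`-cycles of `K`. -/
def cycles [LinearOrder V] (K : PreAbstractSimplicialComplex V) (i : ℤ) :
    Submodule F (Finset V →₀ F) :=
  K.chains F i ⊓ LinearMap.ker (chainBoundary F)

/-- The `i`-boundaries of `K`. -/
def boundaries [LinearOrder V] (K : PreAbstractSimplicialComplex V) (i : ℤ) :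
    Submodule F (Finset V →₀ F) :=
  (K.chains F (i + 1)).map (chainBoundary F)

/-- The reduced simplicial homology `H̃ᵢ(K; F)`, that is, cycles modulo boundaries. -/
abbrev ReducedHomology [LinearOrder V] (K : PreAbstractSimplicialComplex V) (i : ℤ) : Type _ :=
  Subquotient (K.cycles F i) (K.boundaries F i)

/-- `K` has the reduced homology of a point: it vanishes in all degrees. -/
def IsAcyclic [LinearOrder V] (K : PreAbstractSimplicialComplex V) : Prop :=
  ∀ i : ℤ, Subsingleton (K.ReducedHomology F i)

/-- `K` has the reduced homology of the `m`-dimensional sphere: it is `F` in degree `m` and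
vanishes in all other degrees (the `(-1)`-dimensional sphere is the complex `{∅}`). -/
def HasSphereHomology [LinearOrder V] (K : PreAbstractSimplicialComplex V) (m : ℤ) : Prop :=
  Nonempty (K.ReducedHomology F m ≃ₗ[F] F) ∧
    ∀ i : ℤ, i ≠ m → Subsingleton (K.ReducedHomology F i)

/-- `K` is an `F`-homology sphere of dimension `d`: a finite complex such that the link of every
face `σ`, the empty face included, has the homology of a sphere of dimension `d - #σ`.
(Applied to facets, this forces `K` to be pure of dimension `d`.) -/
structure IsHomologySphere [LinearOrder V] (K : PreAbstractSimplicialComplex V) (d : ℤ) :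
    Prop where
  finite : K.faces.Finite
  link_sphere : ∀ σ, K.IsFace σ → (K.link σ).HasSphereHomology F (d - σ.card)

/-- `K` is an `F`-homology ball of dimension `d`: a finite complex whose boundary is an
`F`-homology sphere of dimension `d - 1`, such that the link of every face `σ` is acyclic if `σ`
lies in the boundary and has the homology of a sphere of dimension `d - #σ` otherwise.
(The empty face lies in the boundary, so `K` itself is acyclic; and a facet has the link `{∅}`,
which is not acyclic, so `K` is pure of dimension `d`. A face of dimension `d - 1` has as link
one point or a complex with the homology of two points, so it lies in at most two facets.) -/
structure IsHomologyBall [LinearOrder V] (K : PreAbstractSimplicialComplex V) (d : ℕ) :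
    Prop where
  finite : K.faces.Finite
  boundary_sphere : (K.boundary d).IsHomologySphere F ((d : ℤ) - 1)
  link_boundary : ∀ σ, K.IsFace σ → (K.boundary d).IsFace σ → (K.link σ).IsAcyclic F
  link_interior : ∀ σ, K.IsFace σ → ¬ (K.boundary d).IsFace σ →
    (K.link σ).HasSphereHomology F ((d : ℤ) - σ.card)

end Homology

/-- A `d`-dimensional complex is `k`-stacked if all its faces of codimension at least `k + 1` lie
in its boundary. -/
def IsStacked (K : PreAbstractSimplicialComplex V) (d k : ℕ) : Prop :=
  ∀ σ, K.IsFace σ → (k : ℤ) + 1 ≤ d - simplexDim σ → (K.boundary d).IsFace σ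

/-- A missing face: a set of vertices of `K` that is not a face although all its proper subsets
are. -/
def IsMissingFace (K : PreAbstractSimplicialComplex V) (α : Finset V) : Prop :=
  (∀ v ∈ α, K.IsFace {v}) ∧ ¬ K.IsFace α ∧ ∀ β, β ⊂ α → K.IsFace β

end PreAbstractSimplicialComplex

end

/-! Stackedness makes every link in `B` homologically trivial in degrees at least `k`: links of
boundary faces are acyclic, and an interior face has codimension at most `k`, so its link is a
homology sphere of dimension less than `k`. Such vanishing in all links survives the deletion of
vertices (`exists_chainBoundary_eq_of_avoids`). If `α` were a missing face of dimension greater than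
`k`, deleting all vertices outside `α` would leave the boundary of the simplex `α`, which has
nonzero homology in degree `dim α - 1 ≥ k`. -/

namespace PreAbstractSimplicialComplex

/-! ### Signs and contraction of chains by a vertex. -/

section Contraction

variable {V : Type*} [LinearOrder V] (F : Type*) [Field F]

/-- The incidence sign of the vertex `v` in the simplex `σ`. -/
def incidenceSign (v : V) (σ : Finset V) : F := (-1 : F) ^ (σ.filter (· < v)).card

lemma incidenceSign_ne_zero (v : V) (σ : Finset V) : incidenceSign F v σ ≠ 0 :=
  pow_ne_zero _ (neg_ne_zero.2 one_ne_zero)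

lemma incidenceSign_erase_of_lt {u v : V} {σ : Finset V} (hu : u ∈ σ) (h : u < v) :
    incidenceSign F v (σ.erase u) = -incidenceSign F v σ := by
  have hmem : u ∈ σ.filter (· < v) := Finset.mem_filter.2 ⟨hu, h⟩
  rw [incidenceSign, incidenceSign, Finset.filter_erase,
    ← Finset.card_erase_add_one hmem, pow_succ]
  ring

lemma incidenceSign_erase_of_le {u v : V} {σ : Finset V} (h : v ≤ u) :
    incidenceSign F v (σ.erase u) = incidenceSign F v σ := by
  rw [incidenceSign, incidenceSign, Finset.filter_erase, Finset.erase_eq_of_notMem]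
  simp [h]

/-- Removing the smaller vertex shifts the position of the larger by one, while removing the larger
leaves the smaller in place. Both `∂² = 0` and the anticommutation of `∂` with contraction rest on
this. -/
lemma incidenceSign_mul_erase {u v : V} {σ : Finset V} (hu : u ∈ σ) (hv : v ∈ σ) (h : u ≠ v) :
    incidenceSign F u σ * incidenceSign F v (σ.erase u) =
      -(incidenceSign F v σ * incidenceSign F u (σ.erase v)) := by
  rcases lt_or_gt_of_ne h with h | h
  · rw [incidenceSign_erase_of_lt F hu h, incidenceSign_erase_of_le F h.le]; ring
  · rw [incidenceSign_erase_of_lt F hv h, incidenceSign_erase_of_le F h.le]; ring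

lemma chainBoundary_single (σ : Finset V) (a : F) :
    chainBoundary F (Finsupp.single σ a) =
      ∑ v ∈ σ, Finsupp.single (σ.erase v) (a * incidenceSign F v σ) := by
  simp [chainBoundary, incidenceSign, Finset.smul_sum]

lemma chainBoundary_chainBoundary_single (σ : Finset V) :
    chainBoundary F (chainBoundary F (Finsupp.single σ 1)) = 0 := by
  simp only [chainBoundary_single, map_sum, one_mul]
  rw [Finset.sum_sigma']
  -- Terms cancel in pairs under swapping the order in which two vertices are removed.
  refine Finset.sum_involution (fun p _ => ⟨p.2, p.1⟩) ?_ ?_ ?_ ?_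
  · rintro ⟨u, w⟩ h
    simp only [Finset.mem_sigma, Finset.mem_erase] at h
    rw [incidenceSign_mul_erase F h.1 h.2.2 h.2.1.symm, Finset.erase_right_comm]
    simp
  · rintro ⟨u, w⟩ h - heq
    simp only [Finset.mem_sigma, Finset.mem_erase] at h
    simp only [Sigma.mk.injEq] at heq
    exact h.2.1 heq.1
  · rintro ⟨u, w⟩ h
    simp only [Finset.mem_sigma, Finset.mem_erase] at h ⊢
    exact ⟨h.2.2, h.2.1.symm, h.1⟩
  · rintro ⟨u, w⟩ h
    rfl

/-- The contraction of chains by the vertex `v`: the simplex `σ` is sent to `± σ \ {v}` if it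
contains `v`, and to `0` otherwise. -/
noncomputable def contraction (v : V) : (Finset V →₀ F) →ₗ[F] (Finset V →₀ F) :=
  Finsupp.linearCombination F fun σ : Finset V =>
    if v ∈ σ then Finsupp.single (σ.erase v) (incidenceSign F v σ) else 0

lemma contraction_single_of_mem {v : V} {σ : Finset V} (h : v ∈ σ) (a : F) :
    contraction F v (Finsupp.single σ a) =
      Finsupp.single (σ.erase v) (a * incidenceSign F v σ) := by
  simp [contraction, h]

lemma contraction_single_of_notMem {v : V} {σ : Finset V} (h : v ∉ σ) (a : F) :
    contraction F v (Finsupp.single σ a) = 0 := by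
  simp [contraction, h]

/-- Used to see that the contraction of `c` is a cycle whenever `∂c` avoids `v`. -/
lemma contraction_chainBoundary (v : V) (c : Finset V →₀ F) :
    contraction F v (chainBoundary F c) = -chainBoundary F (contraction F v c) := by
  induction c using Finsupp.induction_linear with
  | zero => simp
  | add c c' h h' => simp only [map_add, h, h', neg_add]
  | single σ a =>
    rw [chainBoundary_single, map_sum]
    by_cases hv : v ∈ σ
    · rw [contraction_single_of_mem F hv, chainBoundary_single, ← Finset.add_sum_erase σ _ hv,
        contraction_single_of_notMem F (Finset.notMem_erase v σ), zero_add,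
        ← Finset.sum_neg_distrib]
      refine Finset.sum_congr rfl fun u hu => ?_
      rw [Finset.mem_erase] at hu
      rw [contraction_single_of_mem F (Finset.mem_erase.2 ⟨hu.1.symm, hv⟩), mul_assoc, mul_assoc,
        incidenceSign_mul_erase F hu.2 hv hu.1, Finset.erase_right_comm]
      simp
    · rw [contraction_single_of_notMem F hv, map_zero, neg_zero]
      exact Finset.sum_eq_zero fun u _ =>
        contraction_single_of_notMem F (fun h => hv (Finset.mem_of_mem_erase h)) _

lemma contraction_eq_zero {v : V} {c : Finset V →₀ F} (h : ∀ σ ∈ c.support, v ∉ σ) :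
    contraction F v c = 0 := by
  rw [contraction, Finsupp.linearCombination_apply]
  exact Finset.sum_eq_zero fun σ hσ => by simp [h σ hσ]

/-- In `∂σ` with `v ∈ σ`, only the term that removes `v` avoids `v`. -/
lemma filter_notMem_chainBoundary {v : V} {c : Finset V →₀ F} (h : ∀ σ ∈ c.support, v ∈ σ) :
    (chainBoundary F c).filter (fun σ => v ∉ σ) = contraction F v c := by
  have hc : c = c.sum Finsupp.single := c.sum_single.symm
  rw [hc, Finsupp.sum, map_sum, map_sum, Finsupp.filter_sum]
  refine Finset.sum_congr rfl fun σ hσ => ?_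
  have hv := h σ hσ
  rw [chainBoundary_single, contraction_single_of_mem F hv, Finsupp.filter_sum,
    Finset.sum_eq_single_of_mem v hv]
  · exact Finsupp.filter_single_of_pos _ (Finset.notMem_erase v σ)
  · intro u _ hu
    exact Finsupp.filter_single_of_neg _ (not_not.2 (Finset.mem_erase.2 ⟨hu.symm, hv⟩))

/-- A chain whose boundary avoids `v` splits into a chain avoiding `v` and the cone from `v` over
its contraction, whose boundary is that contraction. -/
lemma chainBoundary_eq_of_avoids {v : V} {c : Finset V →₀ F}
    (h : ∀ σ ∈ (chainBoundary F c).support, v ∉ σ) :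
    chainBoundary F c =
      chainBoundary F (c.filter (fun σ => v ∉ σ)) + contraction F v c := by
  have hsplit : c.filter (fun σ => v ∈ σ) + c.filter (fun σ => v ∉ σ) = c :=
    Finsupp.filter_add_filter_not c _
  set c₁ := c.filter (fun σ => v ∈ σ) with hc₁
  set c₀ := c.filter (fun σ => v ∉ σ) with hc₀
  have h₁ : ∀ σ ∈ c₁.support, v ∈ σ := fun σ hσ => by
    rw [hc₁, Finsupp.support_filter, Finset.mem_filter] at hσ
    exact hσ.2
  have h₀ : ∀ σ ∈ c₀.support, v ∉ σ := fun σ hσ => by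
    rw [hc₀, Finsupp.support_filter, Finset.mem_filter] at hσ
    exact hσ.2
  have hb₀ : (chainBoundary F c₀).filter (fun σ => v ∉ σ) = chainBoundary F c₀ := by
    conv_rhs => rw [← c₀.sum_single]
    conv_lhs => rw [← c₀.sum_single]
    rw [Finsupp.sum, map_sum, Finsupp.filter_sum]
    refine Finset.sum_congr rfl fun σ hσ => ?_
    rw [chainBoundary_single, Finsupp.filter_sum]
    exact Finset.sum_congr rfl fun u _ =>
      Finsupp.filter_single_of_pos _ fun hv => h₀ σ hσ (Finset.mem_of_mem_erase hv)
  have hb : (chainBoundary F c).filter (fun σ => v ∉ σ) = chainBoundary F c :=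
    Finsupp.filter_eq_self_iff _ _ |>.2 fun σ hσ => h σ (Finsupp.mem_support_iff.2 hσ)
  have hcontr : contraction F v c = contraction F v c₁ := by
    rw [← hsplit, map_add, contraction_eq_zero F h₀, add_zero]
  rw [hcontr, ← filter_notMem_chainBoundary F h₁, ← hb]
  conv_lhs => rw [← hsplit, map_add, Finsupp.filter_add, hb₀]
  rw [add_comm]

lemma exists_of_mem_support_contraction {v : V} {c : Finset V →₀ F} {ρ : Finset V}
    (h : ρ ∈ (contraction F v c).support) : ∃ σ ∈ c.support, v ∈ σ ∧ ρ = σ.erase v := by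
  rw [contraction, Finsupp.linearCombination_apply] at h
  obtain ⟨σ, hσ, hρ⟩ := Finset.mem_biUnion.1 (Finsupp.support_sum h)
  by_cases hv : v ∈ σ
  · rw [if_pos hv] at hρ
    exact ⟨σ, hσ, hv,
      Finset.mem_singleton.1 (Finsupp.support_single_subset (Finsupp.support_smul hρ))⟩
  · simp [hv] at hρ

end Contraction

variable {V : Type*}

lemma IsFace.mono {K : PreAbstractSimplicialComplex V} {σ τ : Finset V} (h : K.IsFace τ)
    (hσ : σ ⊆ τ) : K.IsFace σ := by
  rcases σ.eq_empty_or_nonempty with rfl | hne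
  · exact Or.inl rfl
  · rcases h with rfl | h
    · exact absurd (Finset.subset_empty.1 hσ) hne.ne_empty
    · exact Or.inr ((K.isRelLowerSet_faces h).2 hσ hne)

lemma isFace_link_iff [DecidableEq V] {K : PreAbstractSimplicialComplex V} {σ τ : Finset V}
    (hσ : K.IsFace σ) : (K.link σ).IsFace τ ↔ Disjoint τ σ ∧ K.IsFace (τ ∪ σ) := by
  rcases τ.eq_empty_or_nonempty with rfl | hne
  · simpa [IsFace] using hσ
  · have h : τ ∪ σ ≠ ∅ := (hne.mono Finset.subset_union_left).ne_empty
    simp [IsFace, link, hne, hne.ne_empty]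

variable {F : Type*} [Field F]

lemma le_of_subsingleton_subquotient {M : Type*} [AddCommGroup M] [Module F M]
    {Z B : Submodule F M} (h : Subsingleton (Subquotient Z B)) : Z ≤ B := by
  have h' : Subsingleton (Z ⧸ B.submoduleOf Z) := h
  rw [Submodule.Quotient.subsingleton_iff] at h'
  exact Submodule.submoduleOf_eq_top.1 h'

lemma mem_chains {K : PreAbstractSimplicialComplex V} {i : ℤ} {c : Finset V →₀ F} :
    c ∈ K.chains F i ↔ ∀ σ ∈ c.support, K.IsFace σ ∧ simplexDim σ = i :=
  Finsupp.mem_supported F c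

variable [LinearOrder V]

/-- If the links of all faces of `K` have no homology in degree `i`, then neither have the
subcomplexes of these links that are obtained by deleting a set of vertices. -/
lemma exists_chainBoundary_eq_of_avoids {K : PreAbstractSimplicialComplex V} {i : ℤ}
    (hK : ∀ τ, K.IsFace τ → Subsingleton ((K.link τ).ReducedHomology F i)) (U : Finset V) :
    ∀ τ, K.IsFace τ → ∀ z ∈ (K.link τ).cycles F i, (∀ σ ∈ z.support, Disjoint σ U) →
      ∃ c ∈ (K.link τ).chains F (i + 1), (∀ σ ∈ c.support, Disjoint σ U) ∧
        chainBoundary F c = z := by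
  -- The face `τ` stays universally quantified: deleting `v` calls on the hypothesis for both `τ`
  -- and `insert v τ`.
  induction U using Finset.induction_on with
  | empty =>
    intro τ hτ z hz _
    obtain ⟨c, hc, rfl⟩ := le_of_subsingleton_subquotient (hK τ hτ) hz
    exact ⟨c, hc, fun σ _ => Finset.disjoint_empty_right σ, rfl⟩
  | insert v U _ ih =>
    intro τ hτ z hz hzU
    simp only [Finset.disjoint_insert_right] at hzU ⊢
    obtain ⟨c, hc, hcU, rfl⟩ := ih τ hτ z hz fun σ hσ => (hzU σ hσ).2
    rw [mem_chains] at hc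
    have hsum := chainBoundary_eq_of_avoids F fun σ hσ => (hzU σ hσ).1
    have hc₀ : ∀ σ ∈ (c.filter (fun σ => v ∉ σ)).support, σ ∈ c.support ∧ v ∉ σ := fun σ hσ => by
      rwa [Finsupp.support_filter, Finset.mem_filter] at hσ
    -- If `v` is a vertex of the link of `τ`, the part of `c` through `v` is replaced by a filling
    -- `c'` of its contraction inside the link of `insert v τ`, where no face contains `v`.
    -- Otherwise `c` already avoids `v`.
    by_cases hv : v ∉ τ ∧ K.IsFace (insert v τ)
    · have hb : contraction F v c ∈ (K.link (insert v τ)).cycles F i := by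
        refine ⟨mem_chains.2 fun ρ hρ => ?_, ?_⟩
        · obtain ⟨σ, hσ, hvσ, rfl⟩ := exists_of_mem_support_contraction F hρ
          obtain ⟨hface, hdim⟩ := hc σ hσ
          rw [isFace_link_iff hτ] at hface
          refine ⟨(isFace_link_iff hv.2).2 ⟨?_, ?_⟩, ?_⟩
          · rw [Finset.disjoint_insert_right]
            exact ⟨Finset.notMem_erase v σ, hface.1.mono_left (Finset.erase_subset v σ)⟩
          · rw [Finset.union_insert, ← Finset.insert_union, Finset.insert_erase hvσ]
            exact hface.2
          · have := Finset.card_erase_add_one hvσ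
            unfold simplexDim at hdim ⊢
            lia
        · rw [SetLike.mem_coe, LinearMap.mem_ker, ← neg_eq_zero, ← contraction_chainBoundary]
          exact contraction_eq_zero F fun σ hσ => (hzU σ hσ).1
      obtain ⟨c', hc', hc'U, hbdry⟩ := ih _ hv.2 _ hb fun ρ hρ => by
        obtain ⟨σ, hσ, -, rfl⟩ := exists_of_mem_support_contraction F hρ
        exact (hcU σ hσ).mono_left (Finset.erase_subset v σ)
      rw [mem_chains] at hc'
      refine ⟨c.filter (fun σ => v ∉ σ) + c', add_mem ?_ ?_, fun σ hσ => ?_, ?_⟩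
      · exact mem_chains.2 fun σ hσ => hc σ (hc₀ σ hσ).1
      · refine mem_chains.2 fun σ hσ => ⟨?_, (hc' σ hσ).2⟩
        have hface := (isFace_link_iff hv.2).1 (hc' σ hσ).1
        exact (isFace_link_iff hτ).2 ⟨hface.1.mono_right (Finset.subset_insert v τ),
          hface.2.mono (Finset.union_subset_union_right (Finset.subset_insert v τ))⟩
      · rcases Finset.mem_union.1 (Finsupp.support_add hσ) with hσ | hσ
        · exact ⟨(hc₀ σ hσ).2, hcU σ (hc₀ σ hσ).1⟩
        · have hdis := ((isFace_link_iff hv.2).1 (hc' σ hσ).1).1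
          exact ⟨(Finset.disjoint_insert_right.1 hdis).1, hc'U σ hσ⟩
      · rw [map_add, hbdry, ← hsum]
    · refine ⟨c, mem_chains.2 hc, fun σ hσ => ⟨fun hvσ => hv ?_, hcU σ hσ⟩, rfl⟩
      have hface := (isFace_link_iff hτ).1 (hc σ hσ).1
      exact ⟨Finset.disjoint_left.1 hface.1 hvσ, hface.2.mono
        (Finset.insert_subset (Finset.mem_union_left τ hvσ) Finset.subset_union_right)⟩

lemma IsStacked.subsingleton_reducedHomology_link {B : PreAbstractSimplicialComplex V} {d k : ℕ}
    (hB : B.IsHomologyBall F d) (hk : B.IsStacked d k) {i : ℤ} (hi : (k : ℤ) ≤ i)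
    {τ : Finset V} (hτ : B.IsFace τ) : Subsingleton ((B.link τ).ReducedHomology F i) := by
  by_cases hbd : (B.boundary d).IsFace τ
  · exact hB.link_boundary τ hτ hbd i
  -- Were `i = d - #τ` with `i ≥ k`, the codimension `d - #τ + 1` would be at least `k + 1`, forcing
  -- `τ` into the boundary.
  · refine (hB.link_interior τ hτ hbd).2 i fun h => hbd (hk τ hτ ?_)
    unfold simplexDim
    lia

end PreAbstractSimplicialComplex

open PreAbstractSimplicialComplex in
theorem lemma2 {V : Type*} [LinearOrder V] (F : Type*) [Field F]
    (B : PreAbstractSimplicialComplex V) (d k : ℕ)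
    (hB : B.IsHomologyBall F d) (hk : B.IsStacked d k)
    (α : Finset V) (hα : B.IsMissingFace α) :
    PreAbstractSimplicialComplex.simplexDim α ≤ k := by
  by_contra! hlt
  obtain ⟨-, hnot, hproper⟩ := hα
  have hempty : B.IsFace ∅ := Or.inl rfl
  have hlink : ∀ σ, (B.link ∅).IsFace σ ↔ B.IsFace σ := fun σ => by
    simp [isFace_link_iff hempty]
  obtain ⟨u, hu⟩ : α.Nonempty := Finset.nonempty_iff_ne_empty.2 fun h => hnot (Or.inl h)
  have hsupp : ∀ ρ ∈ (chainBoundary F (Finsupp.single α 1)).support,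
      ∃ v ∈ α, ρ = α.erase v := fun ρ hρ => by
    rw [chainBoundary_single] at hρ
    obtain ⟨v, hv, h⟩ := Finset.mem_biUnion.1 (Finsupp.support_finsetSum hρ)
    exact ⟨v, hv, Finset.mem_singleton.1 (Finsupp.support_single_subset h)⟩
  -- All vertices of `B` outside `α`; chains avoiding `U` live on the subcomplex induced on `α`.
  let U : Finset V := hB.finite.toFinset.biUnion id \ α
  obtain ⟨c, hc, hcU, hbdry⟩ := exists_chainBoundary_eq_of_avoids (K := B) (F := F)
    (i := simplexDim α - 1)
    (fun τ hτ => hk.subsingleton_reducedHomology_link hB (by lia) hτ) U ∅ hempty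
    (chainBoundary F (Finsupp.single α 1))
    ⟨mem_chains.2 fun ρ hρ => by
      obtain ⟨v, hv, rfl⟩ := hsupp ρ hρ
      refine ⟨(hlink _).2 (hproper _ (Finset.erase_ssubset hv)), ?_⟩
      have := Finset.card_erase_add_one hv
      unfold simplexDim
      lia, chainBoundary_chainBoundary_single F α⟩
    (fun ρ hρ => by
      obtain ⟨v, -, rfl⟩ := hsupp ρ hρ
      exact Finset.disjoint_sdiff.mono_left (Finset.erase_subset v α))
  -- A face of dimension `dim α` with vertices in `α` would be `α` itself, which is not a face.
  have hc0 : c = 0 := by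
    rw [← Finsupp.support_eq_empty, Finset.eq_empty_iff_forall_notMem]
    intro σ hσ
    obtain ⟨hface, hdim⟩ := mem_chains.1 hc σ hσ
    rw [hlink] at hface
    have hsub : σ ⊆ α := fun x hx => by
      by_contra hxα
      rcases hface with rfl | hface
      · simp at hx
      · exact Finset.disjoint_left.1 (hcU σ hσ) hx (Finset.mem_sdiff.2
          ⟨Finset.mem_biUnion.2 ⟨σ, hB.finite.mem_toFinset.2 hface, hx⟩, hxα⟩)
    have hcard : α.card ≤ σ.card := by
      unfold simplexDim at hdim
      lia
    exact hnot (Finset.eq_of_subset_of_card_le hsub hcard ▸ hface)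
  -- Yet `∂α ≠ 0`: its coefficient at `α.erase u` is a sign.
  have hcoeff : chainBoundary F (Finsupp.single α 1) (α.erase u) = incidenceSign F u α := by
    rw [chainBoundary_single, Finsupp.finsetSum_apply, Finset.sum_eq_single_of_mem u hu]
    · simp
    · intro v hv hne
      refine Finsupp.single_eq_of_ne fun h => ?_
      exact Finset.notMem_erase u α (h ▸ Finset.mem_erase.2 ⟨hne.symm, hu⟩)
  rw [← hbdry, hc0, map_zero, Finsupp.zero_apply] at hcoeff
  exact incidenceSign_ne_zero F u α hcoeff.symm
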